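/- For $\tau>0$ let $X_\tau$ be the space of locally square summable, $\tau$-periodic functions $f:\mathbb R\to\mathbb C$ with $\int_0^\tau f(t)\,dt=0$. Let $T_1,T_2,T_3,T_4$ be positive integers and let $X:=X_{T_1}+X_{T_2}+X_{T_3}+X_{T_4}$. Call a number $T>0$ the critical length of $X$ if (the restrictions of the functions of) $X$ are dense in $L^2(0,T')$ for every $0<T'<T$ and are not dense in $L^2(0,T')$ for any $T'>T$. An orthogonal function of $X$ is a nonzero real-valued function $h_4\in L^2(0,T)$ such that the closure of $X$ in $L^2(0,T)$ is the orthogonal complement of $h_4$ in $L^2(0,T)$. Suppose that there exist two distinct three-element sets $A_1\ne A_2$ and two distinct two-element sets $B_1\ne B_2$ of indices in $\{1,2,3,4\}$ such that $$\gcd(T_i: i\in A_1)=\gcd(T_i: i\in B_1)\quad\text{and}\quad \gcd(T_i: i\in A_2)=\gcd(T_i: i\in B_2).$$ Then $X$ has a critical length $T$, there exists an orthogonal function $h_4$ of $X$ in $L^2(0,T)$ that is positive almost everywhere in a right neighborhood of $0$, and every such orthogonal function $h_4$ satisfies $h_4\ge 0$ almost everywhere in $(0,T)$. -/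

import Mathlib

open MeasureTheory Set

noncomputable section

/-- The space `X_τ` of locally square summable, `τ`-periodic functions `ℝ → ℂ` of zero mean
value. -/
def periodicZeroMean (τ : ℝ) : Submodule ℂ (ℝ → ℂ) where
  carrier := {f | (∀ a b : ℝ, MemLp f 2 (volume.restrict (Ioo a b))) ∧
    Function.Periodic f τ ∧ ∫ t in Ioo 0 τ, f t = 0}
  add_mem' := by
    rintro f g ⟨hf, hfp, hf0⟩ ⟨hg, hgp, hg0⟩
    refine ⟨fun a b => (hf a b).add (hg a b), hfp.add hgp, ?_⟩
    have h := integral_add ((hf 0 τ).integrable one_le_two) ((hg 0 τ).integrable one_le_two)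
    simpa [hf0, hg0] using h
  zero_mem' := by
    refine ⟨fun a b => MemLp.zero, fun t => rfl, by simp⟩
  smul_mem' := by
    rintro c f ⟨hf, hfp, hf0⟩
    refine ⟨fun a b => (hf a b).const_smul c, fun t => by simp [hfp t], ?_⟩
    simp [integral_const_mul, hf0]

/-- The space `X = X_{T₁} + ⋯ + X_{Tₙ}`. -/
def periodicSum {n : ℕ} (T : Fin n → ℝ) : Submodule ℂ (ℝ → ℂ) :=
  ⨆ i, periodicZeroMean (T i)

/-- The complex Hilbert space `L²(0, L)`. -/
abbrev L2Interval (L : ℝ) : Type := Lp ℂ 2 (volume.restrict (Ioo (0 : ℝ) L))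

/-- The subspace of `L²(0, L)` formed by the restrictions to `(0, L)` of the functions in
`X = X_{T₁} + ⋯ + X_{Tₙ}`. -/
def periodicSumOn {n : ℕ} (T : Fin n → ℝ) (L : ℝ) : Submodule ℂ (L2Interval L) where
  carrier := {u | ∃ f ∈ periodicSum T, u =ᵐ[volume.restrict (Ioo (0 : ℝ) L)] f}
  add_mem' := by
    rintro u v ⟨f, hf, hu⟩ ⟨g, hg, hv⟩
    exact ⟨f + g, add_mem hf hg, (Lp.coeFn_add u v).trans (hu.add hv)⟩
  zero_mem' := ⟨0, zero_mem _, Lp.coeFn_zero ℂ 2 _⟩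
  smul_mem' := by
    rintro c u ⟨f, hf, hu⟩
    exact ⟨c • f, Submodule.smul_mem _ c hf, (Lp.coeFn_smul c u).trans (hu.const_smul c)⟩

/-- `L` is the critical length of `X = X_{T₁} + ⋯ + X_{Tₙ}`: the space `X` is dense in
`L²(0, L')` for all `0 < L' < L`, and it is not dense for any `L' > L`. -/
def IsCriticalLength {n : ℕ} (T : Fin n → ℝ) (L : ℝ) : Prop :=
  0 < L ∧
  (∀ L' : ℝ, 0 < L' → L' < L → Dense (periodicSumOn T L' : Set (L2Interval L'))) ∧
  (∀ L' : ℝ, L < L' → ¬ Dense (periodicSumOn T L' : Set (L2Interval L')))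

/-- The real-valued function `h` (only its values on `(0, L)` matter) is an orthogonal function
of `X = X_{T₁} + ⋯ + X_{Tₙ}` on `(0, L)`: it is a nonzero element of `L²(0, L)`, and the closure
of `X` in `L²(0, L)` is the orthogonal complement of `h`. -/
structure IsOrthogonalFunction {n : ℕ} (T : Fin n → ℝ) (L : ℝ) (h : ℝ → ℝ) : Prop where
  memLp : MemLp (fun t => (h t : ℂ)) 2 (volume.restrict (Ioo (0 : ℝ) L))
  ne_zero : memLp.toLp ≠ 0
  closure_eq : (periodicSumOn T L).topologicalClosure = (Submodule.span ℂ {memLp.toLp})ᗮ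

/-- The normalization of the orthogonal function: `h` is positive in a right neighborhood
of `0`. -/
def PositiveNearZero (h : ℝ → ℝ) : Prop :=
  ∃ δ : ℝ, 0 < δ ∧ ∀ᵐ t ∂(volume.restrict (Ioo (0 : ℝ) δ)), 0 < h t

end

/-! Let `P` be the least common multiple of the `X ^ T i - 1`, `Q = P / (X - 1)` and `d = deg P`.
The critical length is `d`, and the step function whose values on successive unit intervals are the
coefficients of `Q` is an orthogonal function.

Orthogonality: each `1 + X + ⋯ + X ^ (T i - 1)` divides `Q`, which kills the unit interval integrals
of a `T i`-periodic function of mean zero. Conversely (`exists_mem_periodicSum_eqOn`), the `d`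
values `v (x + l)` over each `x ∈ (0, 1)` are interpolated by powers of the `d` roots of `P`. This
splits `v` into functions with `f (x + 1) = ζ * f x`, each `T i`-periodic for some `i`; only the
mean of the piece with `ζ = 1` can obstruct, and orthogonality to the step function removes it.
Hence the codimension is one on `(0, d)`, and there is no obstruction on shorter intervals.

Sign: `P` is an alternating product of factors `X ^ gcd - 1`. The two gcd equalities cancel two
triples against two pairs; what remains of `Q` is a product of quotients `(X ^ a - 1) / (X ^ b - 1)`
with `b ∣ a`, so its coefficients are nonnegative (`quot_coeff_nonneg`). -/

open Polynomial in
/-- The product of the cyclotomic polynomials `Φ_m`, `m ∣ T i` for some `i`: the least common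
multiple of the polynomials `X ^ T i - 1`. -/
noncomputable def cyclotomicLcm {n : ℕ} (T : Fin n → ℕ) (R : Type*) [CommRing R] : R[X] :=
  ∏ m ∈ Finset.univ.biUnion (fun i => (T i).divisors), cyclotomic m R

open Polynomial in
/-- The quotient of `cyclotomicLcm T R` by `X - 1`. -/
noncomputable def cyclotomicLcmQuot {n : ℕ} (T : Fin n → ℕ) (R : Type*) [CommRing R] : R[X] :=
  ∏ m ∈ (Finset.univ.biUnion (fun i => (T i).divisors)).erase 1, cyclotomic m R

/-! ### Divisibility and roots of the cyclotomic least common multiple -/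

namespace cyclotomicLcm

open Polynomial

variable {n : ℕ} {T : Fin n → ℕ}

theorem eq_mul_quot (hn : 0 < n) (hT : ∀ i, 0 < T i) (R : Type*) [CommRing R] :
    cyclotomicLcm T R = (X - 1) * cyclotomicLcmQuot T R := by
  have h1 : 1 ∈ Finset.univ.biUnion (fun i => (T i).divisors) := by
    simp only [Finset.mem_biUnion, Finset.mem_univ, true_and, Nat.mem_divisors]
    exact ⟨⟨0, hn⟩, one_dvd _, (hT _).ne'⟩
  rw [cyclotomicLcm, cyclotomicLcmQuot, ← Finset.mul_prod_erase _ _ h1, cyclotomic_one]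

theorem monic (T : Fin n → ℕ) (R : Type*) [CommRing R] : (cyclotomicLcm T R).Monic :=
  monic_prod_of_monic _ _ fun m _ => cyclotomic.monic m R

theorem quot_monic (T : Fin n → ℕ) (R : Type*) [CommRing R] : (cyclotomicLcmQuot T R).Monic :=
  monic_prod_of_monic _ _ fun m _ => cyclotomic.monic m R

theorem natDegree_eq (hn : 0 < n) (hT : ∀ i, 0 < T i) (R : Type*) [CommRing R] [Nontrivial R] :
    (cyclotomicLcm T R).natDegree = (cyclotomicLcmQuot T R).natDegree + 1 := by
  have h1 : (X - 1 : R[X]) = X - C 1 := by simp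
  rw [eq_mul_quot hn hT, h1, (monic_X_sub_C 1).natDegree_mul (quot_monic T R), natDegree_X_sub_C,
    add_comm]

theorem quot_coeff_zero (hT : ∀ i, 0 < T i) (R : Type*) [CommRing R] :
    (cyclotomicLcmQuot T R).coeff 0 = 1 := by
  rw [coeff_zero_eq_eval_zero, cyclotomicLcmQuot, eval_prod]
  refine Finset.prod_eq_one fun m hm => ?_
  simp only [Finset.mem_erase, Finset.mem_biUnion, Finset.mem_univ, true_and,
    Nat.mem_divisors] at hm
  obtain ⟨h1, i, hi, h0⟩ := hm
  have := Nat.pos_of_dvd_of_pos hi (hT i)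
  rw [← coeff_zero_eq_eval_zero, cyclotomic_coeff_zero R (by omega)]

theorem geom_sum_dvd_quot (hT : ∀ i, 0 < T i) (R : Type*) [CommRing R] (i : Fin n) :
    ∑ k ∈ Finset.range (T i), (X : R[X]) ^ k ∣ cyclotomicLcmQuot T R := by
  rw [← prod_cyclotomic_eq_geom_sum (hT i)]
  exact Finset.prod_dvd_prod_of_subset _ _ _
    (Finset.erase_subset_erase _ (Finset.subset_biUnion_of_mem (fun i => (T i).divisors)
      (Finset.mem_univ i)))

theorem map_quot {R S : Type*} [CommRing R] [CommRing S] (f : R →+* S) :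
    (cyclotomicLcmQuot T R).map f = cyclotomicLcmQuot T S := by
  simp [cyclotomicLcmQuot, Polynomial.map_prod]

/-- The polynomial `cyclotomicLcm T ℂ` has as many distinct roots as its degree, each of them a
`T i`-th root of unity for some `i`. -/
theorem exists_roots (hn : 0 < n) (hT : ∀ i, 0 < T i) {d : ℕ}
    (hd : d = (cyclotomicLcmQuot T ℝ).natDegree + 1) :
    ∃ ζ : Fin d → ℂ, Function.Injective ζ ∧
      (∀ k, ∃ i, ζ k ^ T i = 1) ∧
      (∀ k, ζ k ≠ 1 → (cyclotomicLcmQuot T ℂ).eval (ζ k) = 0) := by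
  have hdeg : (cyclotomicLcm T ℂ).natDegree = d := by
    rw [natDegree_eq hn hT, hd, ← map_quot Complex.ofRealHom,
      natDegree_map_eq_of_injective Complex.ofReal_injective]
  have hN : 0 < ∏ i, T i := Finset.prod_pos fun i _ => hT i
  -- A common multiple of the periods gives a separable multiple of the polynomial, so its roots are
  -- simple.
  have hdvd : cyclotomicLcm T ℂ ∣ X ^ (∏ i, T i) - 1 := by
    rw [← prod_cyclotomic_eq_X_pow_sub_one hN]
    refine Finset.prod_dvd_prod_of_subset _ _ _ fun m hm => ?_
    simp only [Finset.mem_biUnion, Finset.mem_univ, true_and, Nat.mem_divisors] at hm ⊢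
    obtain ⟨i, hi, -⟩ := hm
    exact ⟨hi.trans (Finset.dvd_prod_of_mem T (Finset.mem_univ i)), hN.ne'⟩
  have hsep : (cyclotomicLcm T ℂ).Separable := by
    refine Separable.of_dvd ?_ hdvd
    have := separable_X_pow_sub_C (1 : ℂ) (n := ∏ i, T i) (by exact_mod_cast hN.ne') one_ne_zero
    simpa using this
  have hcard : (cyclotomicLcm T ℂ).roots.toFinset.card = d := by
    rw [Multiset.toFinset_card_of_nodup (nodup_roots hsep), ← hdeg]
    exact (IsAlgClosed.splits _).natDegree_eq_card_roots.symm
  let e := (Finset.equivFinOfCardEq hcard).symm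
  have hroot : ∀ k, (cyclotomicLcm T ℂ).eval (e k : ℂ) = 0 := fun k => by
    have := (e k).2
    rw [Multiset.mem_toFinset, mem_roots (monic T ℂ).ne_zero] at this
    exact this
  refine ⟨fun k => e k, fun a b hab => e.injective (Subtype.ext hab), fun k => ?_, fun k hk => ?_⟩
  · have h := hroot k
    dsimp only
    generalize (e k : ℂ) = z at h ⊢
    rw [cyclotomicLcm, eval_prod, Finset.prod_eq_zero_iff] at h
    obtain ⟨m, hm, h0⟩ := h
    simp only [Finset.mem_biUnion, Finset.mem_univ, true_and, Nat.mem_divisors] at hm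
    obtain ⟨i, hi, -⟩ := hm
    refine ⟨i, ?_⟩
    have h2 : ((X : ℂ[X]) ^ m - 1).eval z = 0 :=
      eval_eq_zero_of_dvd_of_eval_eq_zero (cyclotomic.dvd_X_pow_sub_one m ℂ) h0
    obtain ⟨c, hc⟩ := hi
    rw [hc, pow_mul, show z ^ m = 1 by simpa [sub_eq_zero] using h2, one_pow]
  · have h := hroot k
    dsimp only at hk ⊢
    generalize (e k : ℂ) = z at h hk ⊢
    rw [eq_mul_quot hn hT, eval_mul, mul_eq_zero] at h
    refine h.resolve_left ?_
    simpa [sub_eq_zero] using hk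

/-- Sequences of length `d` are linear combinations of the `d` given exponential sequences. -/
theorem _root_.exists_exponential_interpolation {d : ℕ} {ζ : Fin d → ℂ}
    (hζ : Function.Injective ζ) :
    ∃ M : Fin d → Fin d → ℂ, ∀ (w : Fin d → ℂ) (j : Fin d),
      ∑ k, (∑ l, M k l * w l) * ζ k ^ (j : ℕ) = w j := by
  have hdet : IsUnit (Matrix.vandermonde ζ).transpose.det := by
    rw [Matrix.det_transpose]
    exact (Matrix.det_vandermonde_ne_zero_iff.2 hζ).isUnit
  refine ⟨((Matrix.vandermonde ζ).transpose⁻¹ : Matrix (Fin d) (Fin d) ℂ), fun w j => ?_⟩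
  have h : Matrix.mulVec (Matrix.vandermonde ζ).transpose
      (Matrix.mulVec (Matrix.vandermonde ζ).transpose⁻¹ w) = w := by
    rw [Matrix.mulVec_mulVec, Matrix.mul_nonsing_inv _ hdet, Matrix.one_mulVec]
  have h2 := congrFun h j
  simp only [Matrix.mulVec, dotProduct, Matrix.transpose_apply, Matrix.vandermonde_apply] at h2
  exact (Finset.sum_congr rfl fun k _ => mul_comm _ _).trans h2

/-! ### Inclusion-exclusion over gcds and nonnegativity of the coefficients -/

/-- The 0-1 exponents put all gcd factors over one index set, so that products of them can be
compared one cyclotomic factor at a time. -/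
theorem X_pow_gcd_sub_one {R : Type*} [CommRing R] (hT : ∀ i, 0 < T i)
    {A : Finset (Fin n)} (hA : A.Nonempty) :
    (X : R[X]) ^ A.gcd T - 1 = ∏ m ∈ Finset.univ.biUnion (fun i => (T i).divisors),
      cyclotomic m R ^ (if A ⊆ Finset.univ.filter (fun i => m ∣ T i) then 1 else 0) := by
  obtain ⟨a, ha⟩ := hA
  have h0 : 0 < A.gcd T := Nat.pos_of_dvd_of_pos (Finset.gcd_dvd ha) (hT a)
  rw [← prod_cyclotomic_eq_X_pow_sub_one h0]
  simp only [pow_ite, pow_one, pow_zero]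
  rw [← Finset.prod_filter]
  refine Finset.prod_congr ?_ fun _ _ => rfl
  ext m
  simp only [Nat.mem_divisors, Finset.mem_filter, Finset.mem_biUnion, Finset.mem_univ, true_and,
    Finset.dvd_gcd_iff, Finset.subset_iff]
  exact ⟨fun h => ⟨⟨a, h.1 a ha, (hT a).ne'⟩, fun i hi => h.1 i hi⟩,
    fun h => ⟨fun i hi => h.2 hi, h0.ne'⟩⟩

theorem inclusion_exclusion {T : Fin 4 → ℕ} (hT : ∀ i, 0 < T i) (R : Type*) [CommRing R] :
    cyclotomicLcm T R * (∏ B ∈ Finset.univ.powersetCard 2, ((X : R[X]) ^ B.gcd T - 1)) *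
      (X ^ Finset.univ.gcd T - 1) =
    (∏ i, (X ^ T i - 1)) * ∏ A ∈ Finset.univ.powersetCard 3, (X ^ A.gcd T - 1) := by
  -- For `D = {i | m ∣ T i}` this compares the exponents of the `m`-th cyclotomic factor: the
  -- alternating count of nonempty subsets of `D` is one, written without subtraction.
  have key : ∀ D : Finset (Fin 4), D.Nonempty →
      1 + (∑ B ∈ Finset.univ.powersetCard 2, if B ⊆ D then 1 else 0) +
        (if Finset.univ ⊆ D then 1 else 0) =
      (∑ i, if {i} ⊆ D then 1 else 0) +
        ∑ A ∈ Finset.univ.powersetCard 3, if A ⊆ D then 1 else 0 := by decide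
  have hs : ∀ i, (X : R[X]) ^ T i - 1 = X ^ ({i} : Finset (Fin 4)).gcd T - 1 := by simp
  have hp : ∀ c, 0 < c → ∏ B ∈ (Finset.univ : Finset (Fin 4)).powersetCard c,
      ((X : R[X]) ^ B.gcd T - 1) =
      ∏ m ∈ Finset.univ.biUnion (fun i => (T i).divisors), cyclotomic m R ^
        (∑ B ∈ Finset.univ.powersetCard c,
          if B ⊆ Finset.univ.filter (fun i => m ∣ T i) then 1 else 0) := fun c hc => by
    simp only [← Finset.prod_pow_eq_pow_sum]
    rw [Finset.prod_comm]
    refine Finset.prod_congr rfl fun B hB => X_pow_gcd_sub_one hT ?_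
    rw [← Finset.card_pos, (Finset.mem_powersetCard.1 hB).2]
    exact hc
  rw [hp 2 (by norm_num), hp 3 (by norm_num), X_pow_gcd_sub_one hT Finset.univ_nonempty,
    Finset.prod_congr rfl (fun i _ => (hs i).trans (X_pow_gcd_sub_one hT
      (Finset.singleton_nonempty i))), Finset.prod_comm, cyclotomicLcm]
  simp only [← Finset.prod_mul_distrib, Finset.prod_pow_eq_pow_sum, ← pow_add]
  refine Finset.prod_congr rfl fun m hm => ?_
  rw [← key]
  · rw [pow_add, pow_add, pow_one]
  · simp only [Finset.mem_biUnion, Finset.mem_univ, true_and, Nat.mem_divisors] at hm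
    obtain ⟨i, hi, -⟩ := hm
    exact ⟨i, by simpa using hi⟩

theorem _root_.Polynomial.exists_nonneg_factor {a b : ℕ} (h : b ∣ a) :
    ∃ E : ℝ[X], (∀ k, 0 ≤ E.coeff k) ∧ (X : ℝ[X]) ^ a - 1 = (X ^ b - 1) * E := by
  obtain ⟨c, rfl⟩ := h
  refine ⟨∑ k ∈ Finset.range c, X ^ (b * k), fun k => ?_, ?_⟩
  · rw [finsetSum_coeff]
    refine Finset.sum_nonneg fun j _ => ?_
    rw [coeff_X_pow]
    split_ifs <;> norm_num
  · simp only [pow_mul]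
    rw [mul_comm, geom_sum_mul]

theorem _root_.Polynomial.coeff_mul_nonneg {p q : ℝ[X]} (hp : ∀ k, 0 ≤ p.coeff k)
    (hq : ∀ k, 0 ≤ q.coeff k) (k : ℕ) : 0 ≤ (p * q).coeff k := by
  rw [coeff_mul]
  exact Finset.sum_nonneg fun x _ => mul_nonneg (hp _) (hq _)

theorem _root_.Polynomial.coeff_prod_nonneg {ι : Type*} (s : Finset ι) {p : ι → ℝ[X]}
    (hp : ∀ i ∈ s, ∀ k, 0 ≤ (p i).coeff k) (k : ℕ) : 0 ≤ (∏ i ∈ s, p i).coeff k := by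
  refine Finset.prod_induction p (fun q => ∀ k, 0 ≤ q.coeff k)
    (fun p q hp hq => coeff_mul_nonneg hp hq) (fun k => ?_) hp k
  rw [coeff_one]
  split_ifs <;> norm_num

/-- Four edges of the complete graph on four vertices can be matched with the vertices. -/
theorem _root_.exists_pair_matching : ∀ B₁ ∈ (Finset.univ : Finset (Fin 4)).powersetCard 2,
    ∀ B₂ ∈ (Finset.univ : Finset (Fin 4)).powersetCard 2, B₁ ≠ B₂ →
    ∃ τ : Fin 4 → Fin 4, Finset.univ.image (fun i => ({i, τ i} : Finset (Fin 4))) =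
      ((Finset.univ.powersetCard 2).erase B₁).erase B₂ := by
  -- The remaining four edges form a 4-cycle or a triangle with a pendant edge; in both, every
  -- vertex can select its own incident edge.
  decide +kernel

theorem _root_.exists_erase_erase_eq_pair : ∀ A₁ ∈ (Finset.univ : Finset (Fin 4)).powersetCard 3,
    ∀ A₂ ∈ (Finset.univ : Finset (Fin 4)).powersetCard 3, A₁ ≠ A₂ →
    ∃ i j : Fin 4, {i}ᶜ ≠ ({j}ᶜ : Finset (Fin 4)) ∧
      ((Finset.univ.powersetCard 3).erase A₁).erase A₂ = {{i}ᶜ, {j}ᶜ} := by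
  decide +kernel

theorem quot_coeff_nonneg {T : Fin 4 → ℕ} (hT : ∀ i, 0 < T i)
    {A₁ A₂ B₁ B₂ : Finset (Fin 4)} (hA₁ : A₁.card = 3) (hA₂ : A₂.card = 3) (hA : A₁ ≠ A₂)
    (hB₁ : B₁.card = 2) (hB₂ : B₂.card = 2) (hB : B₁ ≠ B₂)
    (h₁ : A₁.gcd T = B₁.gcd T) (h₂ : A₂.gcd T = B₂.gcd T) (k : ℕ) :
    0 ≤ (cyclotomicLcmQuot T ℝ).coeff k := by
  have mA₁ : A₁ ∈ (Finset.univ : Finset (Fin 4)).powersetCard 3 := by simp [hA₁]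
  have mA₂ : A₂ ∈ (Finset.univ : Finset (Fin 4)).powersetCard 3 := by simp [hA₂]
  have mB₁ : B₁ ∈ (Finset.univ : Finset (Fin 4)).powersetCard 2 := by simp [hB₁]
  have mB₂ : B₂ ∈ (Finset.univ : Finset (Fin 4)).powersetCard 2 := by simp [hB₂]
  obtain ⟨τ, hτ⟩ := exists_pair_matching B₁ mB₁ B₂ mB₂ hB
  obtain ⟨a, b, hab, hC⟩ := exists_erase_erase_eq_pair A₁ mA₁ A₂ mA₂ hA
  have hne : ∀ {A : Finset (Fin 4)}, A.Nonempty → (X : ℝ[X]) ^ A.gcd T - 1 ≠ 0 := by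
    rintro A ⟨i, hi⟩
    have := X_pow_sub_C_ne_zero (Nat.pos_of_dvd_of_pos (Finset.gcd_dvd hi) (hT i)) (1 : ℝ)
    simpa using this
  -- Four indices have an image of `6 - 2 = 4` pairs.
  have hinj : Set.InjOn (fun i => ({i, τ i} : Finset (Fin 4))) (Finset.univ : Finset (Fin 4)) := by
    rw [← Finset.card_image_iff, hτ, Finset.card_erase_of_mem, Finset.card_erase_of_mem mB₁]
    · simp; rfl
    · exact Finset.mem_erase.2 ⟨hB.symm, mB₂⟩
  have hIE := inclusion_exclusion hT ℝ
  rw [← Finset.mul_prod_erase _ _ mB₁,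
    ← Finset.mul_prod_erase _ _ (Finset.mem_erase.2 ⟨hB.symm, mB₂⟩),
    ← Finset.mul_prod_erase _ _ mA₁,
    ← Finset.mul_prod_erase _ _ (Finset.mem_erase.2 ⟨hA.symm, mA₂⟩), h₁, h₂, hC, ← hτ,
    Finset.prod_image hinj, Finset.prod_pair hab] at hIE
  -- Each `X ^ T i - 1` absorbs its matched pair, one leftover triple absorbs the gcd of all four
  -- periods, and the other absorbs the factor `X - 1` separating `P` from `Q`.
  choose E hE hE' using fun i => exists_nonneg_factor
    (Finset.gcd_dvd (f := T) (Finset.mem_insert_self i {τ i}))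
  obtain ⟨F, hF, hF'⟩ := exists_nonneg_factor
    (Finset.gcd_mono (f := T) (Finset.subset_univ ({a}ᶜ : Finset (Fin 4))))
  obtain ⟨G, hG, hG'⟩ := exists_nonneg_factor (one_dvd (({b}ᶜ : Finset (Fin 4)).gcd T))
  rw [Finset.prod_congr rfl fun i _ => hE' i, Finset.prod_mul_distrib, hF', hG', pow_one,
    eq_mul_quot (by norm_num) hT] at hIE
  have hX : (X : ℝ[X]) - 1 ≠ 0 := by simpa using X_sub_C_ne_zero (1 : ℝ)
  have hprod : ∏ i, ((X : ℝ[X]) ^ ({i, τ i} : Finset (Fin 4)).gcd T - 1) ≠ 0 :=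
    Finset.prod_ne_zero_iff.2 fun i _ => hne (Finset.insert_nonempty _ _)
  have hfin : cyclotomicLcmQuot T ℝ = (∏ i, E i) * (F * G) := by
    refine mul_left_cancel₀ (mul_ne_zero (mul_ne_zero (mul_ne_zero (mul_ne_zero
      (hne (A := B₁) ?_) (hne (A := B₂) ?_)) hprod) (hne Finset.univ_nonempty)) hX) ?_
    · rw [← Finset.card_pos]; omega
    · rw [← Finset.card_pos]; omega
    · linear_combination hIE
  rw [hfin]
  exact coeff_mul_nonneg (coeff_prod_nonneg _ fun i _ => hE i) (coeff_mul_nonneg hF hG) k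

end cyclotomicLcm

/-! ### Step functions with polynomial coefficients -/

/-- The step function on `[0, ∞)` whose values are the coefficients of `Q`. -/
noncomputable def Polynomial.stepFunction (Q : Polynomial ℝ) (t : ℝ) : ℝ := Q.coeff ⌊t⌋₊

namespace Polynomial

variable (Q : Polynomial ℝ)

theorem measurable_stepFunction : Measurable Q.stepFunction :=
  (measurable_from_top (f := Q.coeff)).comp Nat.measurable_floor

theorem abs_stepFunction_le (t : ℝ) :
    |Q.stepFunction t| ≤ ∑ j ∈ Finset.range (Q.natDegree + 1), |Q.coeff j| := by
  by_cases h : ⌊t⌋₊ ≤ Q.natDegree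
  · exact Finset.single_le_sum (f := fun j => |Q.coeff j|) (fun j _ => abs_nonneg _)
      (Finset.mem_range.2 (Nat.lt_succ_of_le h))
  · rw [stepFunction, coeff_eq_zero_of_natDegree_lt (not_le.1 h), abs_zero]
    exact Finset.sum_nonneg fun j _ => abs_nonneg _

theorem memLp_stepFunction (μ : Measure ℝ) [IsFiniteMeasure μ] :
    MemLp (fun t => (Q.stepFunction t : ℂ)) 2 μ := by
  refine MemLp.of_bound (Complex.measurable_ofReal.comp Q.measurable_stepFunction).aestronglyMeasurable
    (∑ j ∈ Finset.range (Q.natDegree + 1), |Q.coeff j|) (Filter.Eventually.of_forall fun t => ?_)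
  rw [Complex.norm_real, Real.norm_eq_abs]
  exact Q.abs_stepFunction_le t

theorem stepFunction_eq_zero {t : ℝ} (ht : ((Q.natDegree + 1 : ℕ) : ℝ) ≤ t) :
    Q.stepFunction t = 0 := by
  have h : Q.natDegree + 1 ≤ ⌊t⌋₊ := Nat.le_floor ht
  exact coeff_eq_zero_of_natDegree_lt h

theorem stepFunction_of_mem_Ioo {t : ℝ} {j : ℕ} (ht : t ∈ Ioo (j : ℝ) (j + 1)) :
    Q.stepFunction t = Q.coeff j := by
  rw [stepFunction, (Nat.floor_eq_iff (j.cast_nonneg.trans ht.1.le)).2 ⟨ht.1.le, ht.2⟩]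

theorem setIntegral_stepFunction_mul {f : ℝ → ℂ}
    (hf : MemLp f 2 (volume.restrict (Ioo (0 : ℝ) (Q.natDegree + 1 : ℕ)))) {L : ℝ}
    (hL : ((Q.natDegree + 1 : ℕ) : ℝ) ≤ L) :
    ∫ t in Ioo 0 L, (Q.stepFunction t : ℂ) * f t =
      ∑ j ∈ Finset.range (Q.natDegree + 1), (Q.coeff j : ℂ) * ∫ t in (j : ℝ)..(j + 1), f t := by
  have hint : IntervalIntegrable (fun t => (Q.stepFunction t : ℂ) * f t) volume
      0 (Q.natDegree + 1 : ℕ) := by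
    rw [intervalIntegrable_iff_integrableOn_Ioo_of_le (Nat.cast_nonneg _)]
    exact (Q.memLp_stepFunction _).integrable_mul hf
  rw [setIntegral_eq_of_subset_of_forall_sdiff_eq_zero measurableSet_Ioo
    (Ioo_subset_Ioo_right hL), ← integral_Ioc_eq_integral_Ioo,
    ← intervalIntegral.integral_of_le (Nat.cast_nonneg _)]
  · have h := intervalIntegral.sum_integral_adjacent_intervals (μ := volume)
      (f := fun t => (Q.stepFunction t : ℂ) * f t) (a := fun k : ℕ => (k : ℝ))
      (n := Q.natDegree + 1) (fun k hk => hint.mono_set ?_)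
    · simp only [Nat.cast_zero] at h
      rw [← h]
      refine Finset.sum_congr rfl fun j _ => ?_
      have hj : (j : ℝ) ≤ (j : ℝ) + 1 := by linarith
      push_cast
      rw [intervalIntegral.integral_of_le hj, intervalIntegral.integral_of_le hj,
        integral_Ioc_eq_integral_Ioo, integral_Ioc_eq_integral_Ioo, ← integral_const_mul]
      exact setIntegral_congr_fun measurableSet_Ioo fun t ht => by
        simp only [Q.stepFunction_of_mem_Ioo ht]
    · rw [uIcc_of_le (by exact_mod_cast k.le_succ), uIcc_of_le (Nat.cast_nonneg _)]
      exact Icc_subset_Icc (Nat.cast_nonneg _) (by exact_mod_cast hk)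
  · intro t ht
    have : ((Q.natDegree + 1 : ℕ) : ℝ) ≤ t := not_lt.1 fun h => ht.2 ⟨ht.1.1, h⟩
    rw [Q.stepFunction_eq_zero this, Complex.ofReal_zero, zero_mul]

end Polynomial

/-! ### Orthogonality of the step function to the periodic functions -/

theorem memLp_of_mem_periodicSum {n : ℕ} {T : Fin n → ℝ} {f : ℝ → ℂ} (hf : f ∈ periodicSum T)
    (a b : ℝ) : MemLp f 2 (volume.restrict (Ioo a b)) := by
  refine Submodule.iSup_induction _ (motive := fun f => MemLp f 2 (volume.restrict (Ioo a b))) hf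
    (fun i x hx => hx.1 a b) MemLp.zero fun x y hx hy => hx.add hy

theorem intervalIntegrable_of_memLp {f : ℝ → ℂ}
    (hf : ∀ a b : ℝ, MemLp f 2 (volume.restrict (Ioo a b))) (a b : ℝ) :
    IntervalIntegrable f volume a b := by
  rcases le_total a b with h | h
  · rw [intervalIntegrable_iff_integrableOn_Ioo_of_le h]
    exact (hf a b).integrable one_le_two
  · refine IntervalIntegrable.symm ?_
    rw [intervalIntegrable_iff_integrableOn_Ioo_of_le h]
    exact (hf b a).integrable one_le_two

/-- A multiple of `1 + X + ⋯ + X ^ (N - 1)` annihilates the unit interval means of a function of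
period `N` and mean value zero. -/
theorem sum_coeff_mul_integral_eq_zero {N : ℕ} {f : ℝ → ℂ} (hf : f ∈ periodicZeroMean N)
    {Q : Polynomial ℝ} (hQ : ∑ k ∈ Finset.range N, (Polynomial.X : Polynomial ℝ) ^ k ∣ Q) :
    ∑ j ∈ Finset.range (Q.natDegree + 1), (Q.coeff j : ℂ) * ∫ t in (j : ℝ)..(j + 1), f t = 0 := by
  obtain ⟨R, rfl⟩ := hQ
  -- Encoding the sum as a linear functional of the polynomial reduces the claim to a monomial
  -- cofactor `X ^ m`, where the sum telescopes to the integral of `f` over a full period starting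
  -- at `m`.
  let Λ : Polynomial ℝ →ₗ[ℝ] ℂ := Polynomial.lsum fun j =>
    LinearMap.toSpanSingleton ℝ ℂ (∫ t in (j : ℝ)..(j + 1), f t)
  have hΛ : ∀ P : Polynomial ℝ, Λ P = ∑ j ∈ Finset.range (P.natDegree + 1),
      (P.coeff j : ℂ) * ∫ t in (j : ℝ)..(j + 1), f t := fun P => by
    simp only [Λ, Polynomial.lsum_apply]
    rw [Polynomial.sum_over_range _ (by simp)]
    simp [LinearMap.toSpanSingleton_apply]
  have hmon : ∀ m : ℕ, Λ (Polynomial.X ^ m) = ∫ t in (m : ℝ)..(m + 1), f t := fun m => by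
    simp only [Λ, Polynomial.lsum_apply, ← Polynomial.monomial_one_right_eq_X_pow]
    rw [Polynomial.sum_monomial_index _ _ (by simp)]
    simp [LinearMap.toSpanSingleton_apply]
  rw [← hΛ]
  induction R using Polynomial.induction_on' with
  | add p q hp hq => rw [mul_add, map_add, hp, hq, add_zero]
  | monomial m a =>
    rw [← Polynomial.C_mul_X_pow_eq_monomial, mul_left_comm, ← Polynomial.smul_eq_C_mul, map_smul,
      Finset.sum_mul, map_sum]
    simp only [← pow_add, hmon]
    have h := intervalIntegral.sum_integral_adjacent_intervals (μ := volume) (f := f)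
      (a := fun k : ℕ => ((k + m : ℕ) : ℝ)) (n := N)
      (fun k _ => intervalIntegrable_of_memLp hf.1 _ _)
    have h2 : ∫ t in (((0 + m : ℕ) : ℕ) : ℝ)..((N + m : ℕ) : ℝ), f t = 0 := by
      have h3 := hf.2.1.intervalIntegral_add_eq m 0
      have h4 := hf.2.2
      rw [← integral_Ioc_eq_integral_Ioo, ← intervalIntegral.integral_of_le (Nat.cast_nonneg _)]
        at h4
      rw [zero_add, h4] at h3
      rw [← h3]
      push_cast
      ring_nf
    rw [h2] at h
    have h5 : ∑ x ∈ Finset.range N, ∫ t in ((x + m : ℕ) : ℝ)..((x + m : ℕ) : ℝ) + 1, f t = 0 := by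
      rw [← h]
      refine Finset.sum_congr rfl fun k _ => ?_
      push_cast
      ring_nf
    rw [h5, smul_zero]

theorem setIntegral_stepFunction_mul_eq_zero {n : ℕ} {T : Fin n → ℕ} (hT : ∀ i, 0 < T i)
    {f : ℝ → ℂ} (hf : f ∈ periodicSum fun i => (T i : ℝ)) {L : ℝ}
    (hL : (((cyclotomicLcmQuot T ℝ).natDegree + 1 : ℕ) : ℝ) ≤ L) :
    ∫ t in Ioo 0 L, ((cyclotomicLcmQuot T ℝ).stepFunction t : ℂ) * f t = 0 := by
  rw [Polynomial.setIntegral_stepFunction_mul _ (memLp_of_mem_periodicSum hf _ _) hL]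
  -- Integrability is carried through the induction because additivity of the integrals needs it.
  have key : (∀ a b : ℝ, MemLp f 2 (volume.restrict (Ioo a b))) ∧
      ∑ j ∈ Finset.range ((cyclotomicLcmQuot T ℝ).natDegree + 1),
        ((cyclotomicLcmQuot T ℝ).coeff j : ℂ) * ∫ t in (j : ℝ)..(j + 1), f t = 0 := by
    refine Submodule.iSup_induction _ (motive := fun f : ℝ → ℂ =>
      (∀ a b : ℝ, MemLp f 2 (volume.restrict (Ioo a b))) ∧
      ∑ j ∈ Finset.range ((cyclotomicLcmQuot T ℝ).natDegree + 1),
        ((cyclotomicLcmQuot T ℝ).coeff j : ℂ) * ∫ t in (j : ℝ)..(j + 1), f t = 0) hf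
      (fun i x hx => ⟨hx.1, sum_coeff_mul_integral_eq_zero hx
        (cyclotomicLcm.geom_sum_dvd_quot hT ℝ i)⟩) ⟨fun a b => MemLp.zero, by simp⟩
      fun x y hx hy => ⟨fun a b => (hx.1 a b).add (hy.1 a b), ?_⟩
    rw [← add_zero (0 : ℂ)]
    nth_rewrite 1 [← hx.2]
    rw [← hy.2, ← Finset.sum_add_distrib]
    refine Finset.sum_congr rfl fun j _ => ?_
    rw [← mul_add, ← intervalIntegral.integral_add (intervalIntegrable_of_memLp hx.1 _ _)
      (intervalIntegrable_of_memLp hy.1 _ _)]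
    rfl
  exact key.2

/-! ### Functions multiplied by a constant under unit translation -/

section Floquet

variable {f : ℝ → ℂ} {ζ : ℂ}

theorem apply_add_nat_of_forall_apply_add_one (hf : ∀ x, f (x + 1) = ζ * f x) (m : ℕ) (x : ℝ) :
    f (x + m) = ζ ^ m * f x := by
  induction m with
  | zero => simp
  | succ m ih => rw [Nat.cast_succ, ← add_assoc, hf, ih, pow_succ]; ring

theorem integral_add_nat_of_forall_apply_add_one (hf : ∀ x, f (x + 1) = ζ * f x) (m : ℕ) :
    ∫ t in (m : ℝ)..(m + 1), f t = ζ ^ m * ∫ t in (0 : ℝ)..1, f t := by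
  have h := intervalIntegral.integral_comp_add_right (a := 0) (b := 1) f (m : ℝ)
  simp only [apply_add_nat_of_forall_apply_add_one hf, intervalIntegral.integral_const_mul] at h
  rw [h, zero_add, add_comm]

theorem memLp_of_forall_apply_add_one (hf : ∀ x, f (x + 1) = ζ * f x) (hζ : ‖ζ‖ = 1)
    (hfm : StronglyMeasurable f) (hf2 : MemLp f 2 (volume.restrict (Ioo 0 1))) (a b : ℝ) :
    MemLp f 2 (volume.restrict (Ioo a b)) := by
  rw [memLp_two_iff_integrable_sq_norm hfm.aestronglyMeasurable] at hf2 ⊢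
  have hp : Function.Periodic (fun x => ‖f x‖ ^ 2) 1 := fun x => by
    simp only [hf, norm_mul, hζ, one_mul]
  have h01 : IntervalIntegrable (fun x => ‖f x‖ ^ 2) volume 0 (0 + 1) := by
    rw [zero_add, intervalIntegrable_iff_integrableOn_Ioo_of_le zero_le_one]
    exact hf2
  have h := hp.intervalIntegrable one_ne_zero h01 a b
  rcases le_total a b with hab | hab
  · rwa [intervalIntegrable_iff_integrableOn_Ioo_of_le hab] at h
  · rw [Ioo_eq_empty hab.not_gt]
    simp

/-- The integral over a period is the geometric sum of `ζ` times the integral over `(0, 1)`; the sum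
vanishes unless `ζ = 1`, hence the extra condition in that case only. -/
theorem mem_periodicZeroMean_of_forall_apply_add_one (hf : ∀ x, f (x + 1) = ζ * f x) {N : ℕ}
    (hN : 0 < N) (hζ : ζ ^ N = 1) (hfm : StronglyMeasurable f)
    (hf2 : MemLp f 2 (volume.restrict (Ioo 0 1)))
    (h0 : ζ = 1 → ∫ t in (0 : ℝ)..1, f t = 0) : f ∈ periodicZeroMean N := by
  have hL := memLp_of_forall_apply_add_one hf (Complex.norm_eq_one_of_pow_eq_one hζ hN.ne') hfm hf2
  refine ⟨hL, fun x => by rw [apply_add_nat_of_forall_apply_add_one hf, hζ, one_mul], ?_⟩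
  have h := intervalIntegral.sum_integral_adjacent_intervals (μ := volume) (f := f)
      (a := fun k : ℕ => (k : ℝ)) (n := N) (fun k _ => intervalIntegrable_of_memLp hL _ _)
  rw [← integral_Ioc_eq_integral_Ioo, ← intervalIntegral.integral_of_le (Nat.cast_nonneg _)]
  simp only [Nat.cast_zero] at h
  rw [← h]
  push_cast
  simp only [integral_add_nat_of_forall_apply_add_one hf]
  rw [← Finset.sum_mul]
  by_cases h1 : ζ = 1
  · rw [h0 h1, mul_zero]
  · have := mul_geom_sum ζ N
    rw [hζ, sub_self, mul_eq_zero] at this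
    rw [this.resolve_left (sub_ne_zero.2 h1), zero_mul]

end Floquet

/-- Every function on `(0, d)` orthogonal to the step function of `cyclotomicLcmQuot T ℝ` is the
restriction of a function in `periodicSum T`. -/
theorem exists_mem_periodicSum_eqOn {n : ℕ} (hn : 0 < n) {T : Fin n → ℕ} (hT : ∀ i, 0 < T i)
    {v : ℝ → ℂ} (hvm : StronglyMeasurable v)
    (hv2 : MemLp v 2 (volume.restrict
      (Ioo (0 : ℝ) ((cyclotomicLcmQuot T ℝ).natDegree + 1 : ℕ))))
    (hv : ∫ t in Ioo (0 : ℝ) ((cyclotomicLcmQuot T ℝ).natDegree + 1 : ℕ),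
      ((cyclotomicLcmQuot T ℝ).stepFunction t : ℂ) * v t = 0)
    (h1 : (cyclotomicLcmQuot T ℝ).eval 1 ≠ 0) :
    ∃ f ∈ periodicSum fun i => (T i : ℝ),
      EqOn f v (Ioo (0 : ℝ) ((cyclotomicLcmQuot T ℝ).natDegree + 1 : ℕ)) := by
  set Q := cyclotomicLcmQuot T ℝ
  obtain ⟨ζ, hinj, hone, hroot⟩ := cyclotomicLcm.exists_roots hn hT rfl
  obtain ⟨M, hM⟩ := exists_exponential_interpolation hinj
  have hnorm : ∀ k, ‖ζ k‖ = 1 := fun k => by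
    obtain ⟨i, hi⟩ := hone k
    exact Complex.norm_eq_one_of_pow_eq_one hi (hT i).ne'
  -- The interpolation matrix does not depend on the fibre, so the coefficients inherit
  -- measurability and square integrability from `v`. The integer power extends each piece to the
  -- whole line.
  let F : Fin (Q.natDegree + 1) → ℝ → ℂ := fun k x =>
    (∑ l, M k l * v (Int.fract x + (l : ℕ))) * ζ k ^ ⌊x⌋
  have hF : ∀ k x, F k (x + 1) = ζ k * F k x := fun k x => by
    have h0 : ζ k ≠ 0 := norm_ne_zero_iff.1 (by rw [hnorm k]; exact one_ne_zero)
    simp only [F, Int.fract_add_one, Int.floor_add_one, zpow_add₀ h0, zpow_one]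
    ring
  have hFm : ∀ k, StronglyMeasurable (F k) := fun k => by
    refine Measurable.stronglyMeasurable (Measurable.mul ?_ ?_)
    · exact Finset.measurable_fun_sum _ fun l _ => Measurable.const_mul
        (hvm.measurable.comp (measurable_fract.add_const _)) _
    · exact (measurable_from_top (f := fun m : ℤ => ζ k ^ m)).comp Int.measurable_floor
  have hF2 : ∀ k, MemLp (F k) 2 (volume.restrict (Ioo 0 1)) := fun k => by
    have hA : MemLp (fun x => ∑ l, M k l * v (x + (l : ℕ))) 2 (volume.restrict (Ioo 0 1)) := by
      refine memLp_finsetSum _ fun l _ => MemLp.const_mul ?_ _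
      have hl : MemLp v 2 (volume.restrict (Ioo (l : ℝ) (l + 1))) := by
        refine hv2.mono_measure (Measure.restrict_mono (Ioo_subset_Ioo (Nat.cast_nonneg _) ?_)
          le_rfl)
        exact_mod_cast l.2
      have := hl.comp_measurePreserving ((measurePreserving_add_right volume
        ((l : ℕ) : ℝ)).restrict_preimage measurableSet_Ioo)
      rwa [preimage_add_const_Ioo, sub_self, add_sub_cancel_left] at this
    refine hA.ae_eq ?_
    filter_upwards [ae_restrict_mem measurableSet_Ioo] with x hx
    have hfl : ⌊x⌋ = 0 := Int.floor_eq_iff.2 ⟨by simpa using hx.1.le, by simpa using hx.2⟩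
    have hfr : Int.fract x = x := by rw [Int.fract, hfl]; simp
    simp only [F, hfl, hfr, zpow_zero, mul_one]
  have hFL : ∀ k a b, MemLp (F k) 2 (volume.restrict (Ioo a b)) := fun k =>
    memLp_of_forall_apply_add_one (hF k) (hnorm k) (hFm k) (hF2 k)
  have hsum : EqOn (fun x => ∑ k, F k x) v (Ioo (0 : ℝ) (Q.natDegree + 1 : ℕ)) := fun x hx => by
    have hlt : ⌊x⌋₊ < Q.natDegree + 1 := (Nat.floor_lt hx.1.le).2 hx.2
    have h := hM (fun l => v (Int.fract x + (l : ℕ))) ⟨⌊x⌋₊, hlt⟩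
    have hfl : ((⌊x⌋₊ : ℕ) : ℤ) = ⌊x⌋ := Int.natCast_floor_eq_floor hx.1.le
    have hfr : Int.fract x + ((⌊x⌋₊ : ℕ) : ℝ) = x := by
      rw [← Int.cast_natCast, hfl, Int.fract_add_floor]
    simp only [hfr] at h
    simp only [F, ← hfl, zpow_natCast]
    exact h
  -- Pairing a piece with the step function evaluates `Q` at its multiplier. All terms with `ζ k ≠
  -- 1` vanish, so `Q(1) ≠ 0` forces mean zero for the piece with multiplier one.
  have hzero : ∑ k, (cyclotomicLcmQuot T ℂ).eval (ζ k) * ∫ t in (0 : ℝ)..1, F k t = 0 := by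
    have e1 : ∫ t in Ioo (0 : ℝ) (Q.natDegree + 1 : ℕ), (Q.stepFunction t : ℂ) * ∑ k, F k t = 0 := by
      rw [← hv]
      exact setIntegral_congr_fun measurableSet_Ioo fun t ht => by
        simp only [← hsum ht]
    simp only [Finset.mul_sum] at e1
    rw [← e1, integral_finsetSum _ fun k _ =>
      (show Integrable (fun t => (Q.stepFunction t : ℂ) * F k t) _ from
        (Q.memLp_stepFunction _).integrable_mul (hFL k _ _))]
    refine Finset.sum_congr rfl fun k _ => ?_
    rw [Q.setIntegral_stepFunction_mul (hFL k _ _) le_rfl]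
    simp only [integral_add_nat_of_forall_apply_add_one (hF k)]
    rw [← cyclotomicLcm.map_quot Complex.ofRealHom, Polynomial.eval_map,
      Polynomial.eval₂_eq_sum_range, Finset.sum_mul]
    exact Finset.sum_congr rfl fun j _ => mul_assoc _ _ _
  refine ⟨fun x => ∑ k, F k x, ?_, hsum⟩
  have hmem : ∑ k, F k ∈ periodicSum fun i => (T i : ℝ) := by
    refine Submodule.sum_mem _ fun k _ => ?_
    obtain ⟨i, hi⟩ := hone k
    refine Submodule.mem_iSup_of_mem i (mem_periodicZeroMean_of_forall_apply_add_one (hF k) (hT i)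
      hi (hFm k) (hF2 k) fun hk => ?_)
    rw [Finset.sum_eq_single k (fun l _ hl => by
      rw [hroot l fun h => hl (hinj (h.trans hk.symm)), zero_mul]) (by simp), hk] at hzero
    refine (mul_eq_zero.1 hzero).resolve_left ?_
    rw [← cyclotomicLcm.map_quot Complex.ofRealHom, Polynomial.eval_map, Polynomial.eval₂_at_one]
    simpa using h1
  convert hmem using 1
  ext x
  simp

/-! ### The orthogonal complement in `L²` and the critical length -/

namespace Polynomial

variable (Q : Polynomial ℝ)

/-- The step function of `Q` as an element of `L²(0, L)`. -/
noncomputable def stepLp (L : ℝ) : L2Interval L :=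
  (Q.memLp_stepFunction (volume.restrict (Ioo (0 : ℝ) L))).toLp

theorem coeFn_stepLp (L : ℝ) :
    Q.stepLp L =ᵐ[volume.restrict (Ioo (0 : ℝ) L)] fun t => (Q.stepFunction t : ℂ) :=
  MemLp.coeFn_toLp _

theorem inner_stepLp {L : ℝ} (u : L2Interval L) :
    inner ℂ (Q.stepLp L) u = ∫ t in Ioo 0 L, (Q.stepFunction t : ℂ) * u t := by
  rw [L2.inner_def]
  refine integral_congr_ae ?_
  filter_upwards [Q.coeFn_stepLp L] with t ht
  rw [ht, RCLike.inner_apply, Complex.conj_ofReal, mul_comm]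

end Polynomial

theorem exists_mem_Ioo_of_ae {δ L : ℝ} (hδ : 0 < δ) (hδL : δ ≤ L) {p : ℝ → Prop}
    (hp : ∀ᵐ t ∂(volume.restrict (Ioo (0 : ℝ) L)), p t) : ∃ t ∈ Ioo 0 δ, p t := by
  have h := ae_restrict_of_ae_restrict_of_subset (Ioo_subset_Ioo_right hδL) hp
  have : NeZero (volume.restrict (Ioo (0 : ℝ) δ)) := ⟨by
    rw [Ne, Measure.restrict_eq_zero]
    simp [hδ]⟩
  obtain ⟨t, h1, h2⟩ := (h.and (ae_restrict_mem measurableSet_Ioo)).exists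
  exact ⟨t, h2, h1⟩

theorem Polynomial.stepLp_ne_zero {Q : Polynomial ℝ} (hQ : Q.coeff 0 = 1) {L : ℝ} (hL : 1 ≤ L) :
    Q.stepLp L ≠ 0 := fun h => by
  have h1 := Q.coeFn_stepLp L
  rw [h] at h1
  obtain ⟨t, ht, ht1, ht2⟩ := exists_mem_Ioo_of_ae one_pos hL
    (h1.and (Lp.coeFn_zero ℂ 2 (volume.restrict (Ioo (0 : ℝ) L))))
  have h2 := Q.stepFunction_of_mem_Ioo (t := t) (j := 0) (by simpa using ht)
  rw [ht2] at ht1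
  simp [h2, hQ] at ht1

section

variable {n : ℕ} {T : Fin n → ℕ}

theorem inner_stepLp_of_mem_periodicSumOn (hT : ∀ i, 0 < T i) {L : ℝ}
    (hL : (((cyclotomicLcmQuot T ℝ).natDegree + 1 : ℕ) : ℝ) ≤ L) {u : L2Interval L}
    (hu : u ∈ periodicSumOn (fun i => (T i : ℝ)) L) :
    inner ℂ ((cyclotomicLcmQuot T ℝ).stepLp L) u = 0 := by
  obtain ⟨f, hf, huf⟩ := hu
  rw [Polynomial.inner_stepLp, ← setIntegral_stepFunction_mul_eq_zero hT hf hL]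
  refine integral_congr_ae ?_
  filter_upwards [huf] with t ht
  rw [ht]

theorem periodicSumOn_eq_orthogonal (hn : 0 < n) (hT : ∀ i, 0 < T i)
    (h1 : (cyclotomicLcmQuot T ℝ).eval 1 ≠ 0) :
    periodicSumOn (fun i => (T i : ℝ)) ((cyclotomicLcmQuot T ℝ).natDegree + 1 : ℕ) =
      (Submodule.span ℂ {(cyclotomicLcmQuot T ℝ).stepLp
        ((cyclotomicLcmQuot T ℝ).natDegree + 1 : ℕ)})ᗮ := by
  ext u
  rw [Submodule.mem_orthogonal_singleton_iff_inner_right]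
  refine ⟨fun hu => inner_stepLp_of_mem_periodicSumOn hT le_rfl hu, fun hu => ?_⟩
  rw [Polynomial.inner_stepLp] at hu
  obtain ⟨f, hf, hfu⟩ := exists_mem_periodicSum_eqOn hn hT (Lp.stronglyMeasurable u)
    (Lp.memLp u) hu h1
  refine ⟨f, hf, ?_⟩
  filter_upwards [ae_restrict_mem measurableSet_Ioo] with t ht
  exact (hfu ht).symm

theorem isOrthogonalFunction_stepFunction (hn : 0 < n) (hT : ∀ i, 0 < T i)
    (h1 : (cyclotomicLcmQuot T ℝ).eval 1 ≠ 0) :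
    IsOrthogonalFunction (fun i => (T i : ℝ)) ((cyclotomicLcmQuot T ℝ).natDegree + 1 : ℕ)
      (cyclotomicLcmQuot T ℝ).stepFunction where
  memLp := Polynomial.memLp_stepFunction _ _
  ne_zero := Polynomial.stepLp_ne_zero (cyclotomicLcm.quot_coeff_zero hT ℝ) (by simp)
  closure_eq := by
    rw [periodicSumOn_eq_orthogonal hn hT h1]
    exact (Submodule.isClosed_orthogonal _).submodule_topologicalClosure_eq

/-- Every element is attained: it is extended to `(0, d)` so as to be orthogonal to the step
function, using the free room to the right of `L`. -/
theorem dense_periodicSumOn (hn : 0 < n) (hT : ∀ i, 0 < T i)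
    (h1 : (cyclotomicLcmQuot T ℝ).eval 1 ≠ 0) {L : ℝ} (hL0 : 0 < L)
    (hL : L < ((cyclotomicLcmQuot T ℝ).natDegree + 1 : ℕ)) :
    Dense (periodicSumOn (fun i => (T i : ℝ)) L : Set (L2Interval L)) := by
  suffices h : ∀ u, u ∈ periodicSumOn (fun i => (T i : ℝ)) L by
    rw [show (periodicSumOn (fun i => (T i : ℝ)) L : Set (L2Interval L)) = univ from
      eq_univ_of_forall h]
    exact dense_univ
  intro u
  set Q := cyclotomicLcmQuot T ℝ
  have hlead : Q.coeff Q.natDegree = 1 := cyclotomicLcm.quot_monic T ℝ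
  set d : ℝ := ((Q.natDegree + 1 : ℕ) : ℝ) with hd
  have hd' : d = Q.natDegree + 1 := by rw [hd]; push_cast; rfl
  -- On `(m, d)` the step function equals the leading coefficient 1, so a constant there can correct
  -- the pairing to zero without touching `(0, L)`.
  set m : ℝ := max L Q.natDegree
  have hm0 : 0 ≤ m := hL0.le.trans (le_max_left _ _)
  have hmd : m < d := max_lt hL (by rw [hd']; linarith)
  let v₀ : ℝ → ℂ := (Ioo 0 L).indicator u
  let I : ℂ := ∫ t in Ioo 0 d, (Q.stepFunction t : ℂ) * v₀ t
  let v₁ : ℝ → ℂ := (Ioo m d).indicator fun _ => -I / (d - m : ℝ)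
  have hv₀m : StronglyMeasurable v₀ := (Lp.stronglyMeasurable u).indicator measurableSet_Ioo
  have hv₁m : StronglyMeasurable v₁ := stronglyMeasurable_const.indicator measurableSet_Ioo
  have hv₀ : MemLp v₀ 2 (volume.restrict (Ioo 0 d)) :=
    ((memLp_indicator_iff_restrict measurableSet_Ioo).2 (Lp.memLp u)).mono_measure
      Measure.restrict_le_self
  have hv₁ : MemLp v₁ 2 (volume.restrict (Ioo 0 d)) := (memLp_const _).indicator measurableSet_Ioo
  have hint₁ : ∫ t in Ioo 0 d, (Q.stepFunction t : ℂ) * v₁ t = -I := by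
    have e : ∀ t, (Q.stepFunction t : ℂ) * v₁ t =
        (Ioo m d).indicator (fun t => -I / (d - m : ℝ)) t := fun t => by
      by_cases ht : t ∈ Ioo m d
      · have := Q.stepFunction_of_mem_Ioo (t := t) (j := Q.natDegree)
          ⟨(le_max_right _ _).trans_lt ht.1, by rw [← hd']; exact ht.2⟩
        rw [this, hlead, Complex.ofReal_one, one_mul]
      · simp only [v₁, indicator_of_notMem ht, mul_zero]
    simp only [e]
    rw [setIntegral_indicator measurableSet_Ioo, inter_eq_right.2 (Ioo_subset_Ioo_left hm0),
      setIntegral_const, Real.volume_real_Ioo_of_le hmd.le, Complex.real_smul, mul_div_cancel₀]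
    exact_mod_cast (sub_pos.2 hmd).ne'
  obtain ⟨f, hf, hfv⟩ := exists_mem_periodicSum_eqOn hn hT (hv₀m.add hv₁m) (hv₀.add hv₁) (by
    have hi := fun v (hv : MemLp v 2 (volume.restrict (Ioo 0 d))) =>
      show Integrable (fun t => (Q.stepFunction t : ℂ) * v t) (volume.restrict (Ioo 0 d)) from
        (Q.memLp_stepFunction _).integrable_mul hv
    have hadd := integral_add (hi _ hv₀) (hi _ hv₁)
    rw [hint₁, show ∫ t in Ioo 0 d, (Q.stepFunction t : ℂ) * v₀ t = I from rfl,
      add_neg_cancel] at hadd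
    simpa only [Pi.add_apply, mul_add] using hadd) h1
  refine ⟨f, hf, ?_⟩
  filter_upwards [ae_restrict_mem measurableSet_Ioo] with t ht
  have htm : t ∉ Ioo m d := fun h => (ht.2.trans_le (le_max_left _ _)).not_gt h.1
  rw [hfv ⟨ht.1, ht.2.trans hL⟩, Pi.add_apply]
  simp only [v₀, v₁, indicator_of_mem ht, indicator_of_notMem htm, add_zero]

theorem isCriticalLength_natDegree (hn : 0 < n) (hT : ∀ i, 0 < T i)
    (h1 : (cyclotomicLcmQuot T ℝ).eval 1 ≠ 0) :
    IsCriticalLength (fun i => (T i : ℝ)) ((cyclotomicLcmQuot T ℝ).natDegree + 1 : ℕ) := by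
  refine ⟨by exact_mod_cast Nat.succ_pos _, fun L h0 hL => dense_periodicSumOn hn hT h1 h0 hL,
    fun L hL hD => ?_⟩
  -- Beyond `d` the step function is zero, so it stays a nonzero vector orthogonal to the space.
  refine Polynomial.stepLp_ne_zero (cyclotomicLcm.quot_coeff_zero hT ℝ) (le_trans (by simp) hL.le)
    (hD.eq_zero_of_inner_left ℂ fun u hu => inner_stepLp_of_mem_periodicSumOn hT hL.le hu)

end

/-- Two orthogonal functions that are positive near `0` are positive multiples of each other. -/
theorem IsOrthogonalFunction.exists_pos_mul {n : ℕ} {T : Fin n → ℝ} {L : ℝ} (hL : 0 < L)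
    {g h : ℝ → ℝ} (hg : IsOrthogonalFunction T L g) (hg0 : PositiveNearZero g)
    (hh : IsOrthogonalFunction T L h) (hh0 : PositiveNearZero h) :
    ∃ r : ℝ, 0 < r ∧ ∀ᵐ t ∂(volume.restrict (Ioo (0 : ℝ) L)), h t = r * g t := by
  have hspan : Submodule.span ℂ {hg.memLp.toLp} = Submodule.span ℂ {hh.memLp.toLp} := by
    rw [← Submodule.orthogonal_orthogonal (Submodule.span ℂ {hg.memLp.toLp}), ← hg.closure_eq,
      hh.closure_eq, Submodule.orthogonal_orthogonal]
  have hmem : hh.memLp.toLp ∈ Submodule.span ℂ {hg.memLp.toLp} := by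
    rw [hspan]
    exact Submodule.mem_span_singleton_self _
  obtain ⟨c, hc⟩ := Submodule.mem_span_singleton.1 hmem
  have hae : ∀ᵐ t ∂(volume.restrict (Ioo (0 : ℝ) L)), (h t : ℂ) = c * g t := by
    filter_upwards [hh.memLp.coeFn_toLp, hg.memLp.coeFn_toLp, Lp.coeFn_smul c hg.memLp.toLp]
      with t e1 e2 e3
    rw [← e1, ← hc, e3, Pi.smul_apply, e2, smul_eq_mul]
  obtain ⟨δ, hδ, hgδ⟩ := hg0
  obtain ⟨ε, hε, hhε⟩ := hh0
  have hη : 0 < min (min δ ε) L := lt_min (lt_min hδ hε) hL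
  have hall : ∀ᵐ t ∂(volume.restrict (Ioo (0 : ℝ) (min (min δ ε) L))),
      0 < g t ∧ 0 < h t ∧ (h t : ℂ) = c * g t := by
    filter_upwards [ae_restrict_of_ae_restrict_of_subset (Ioo_subset_Ioo_right
        ((min_le_left _ _).trans (min_le_left _ _))) hgδ,
      ae_restrict_of_ae_restrict_of_subset (Ioo_subset_Ioo_right
        ((min_le_left _ _).trans (min_le_right _ _))) hhε,
      ae_restrict_of_ae_restrict_of_subset (Ioo_subset_Ioo_right (min_le_right _ _)) hae]
      with t e1 e2 e3
    exact ⟨e1, e2, e3⟩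
  obtain ⟨t, -, hgt, hht, ht⟩ := exists_mem_Ioo_of_ae hη le_rfl hall
  -- A single point where both functions are positive makes the complex scalar real and positive.
  have hcr : c = ((h t / g t : ℝ) : ℂ) := by
    have : (g t : ℂ) ≠ 0 := by exact_mod_cast hgt.ne'
    rw [Complex.ofReal_div, ht, mul_div_cancel_right₀ _ this]
  refine ⟨h t / g t, div_pos hht hgt, ?_⟩
  filter_upwards [hae] with s hs
  rw [hcr] at hs
  exact_mod_cast hs

theorem proposition7p1 (T : Fin 4 → ℕ) (hT : ∀ i, 0 < T i)
    (hgcd : ∃ A₁ A₂ B₁ B₂ : Finset (Fin 4),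
      A₁.card = 3 ∧ A₂.card = 3 ∧ A₁ ≠ A₂ ∧ B₁.card = 2 ∧ B₂.card = 2 ∧ B₁ ≠ B₂ ∧
      A₁.gcd T = B₁.gcd T ∧ A₂.gcd T = B₂.gcd T) :
    ∃ L : ℝ, IsCriticalLength (fun i => (T i : ℝ)) L ∧
      (∃ h : ℝ → ℝ, IsOrthogonalFunction (fun i => (T i : ℝ)) L h ∧ PositiveNearZero h) ∧
      ∀ h : ℝ → ℝ, IsOrthogonalFunction (fun i => (T i : ℝ)) L h → PositiveNearZero h →
        ∀ᵐ t ∂(MeasureTheory.volume.restrict (Set.Ioo (0 : ℝ) L)), 0 ≤ h t := by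
  obtain ⟨A₁, A₂, B₁, B₂, hA₁, hA₂, hA, hB₁, hB₂, hB, e₁, e₂⟩ := hgcd
  have hnonneg : ∀ k, 0 ≤ (cyclotomicLcmQuot T ℝ).coeff k :=
    cyclotomicLcm.quot_coeff_nonneg hT hA₁ hA₂ hA hB₁ hB₂ hB e₁ e₂
  have h0 := cyclotomicLcm.quot_coeff_zero hT ℝ
  -- `Q(1)` is a sum of nonnegative coefficients whose constant term is 1.
  have h1 : (cyclotomicLcmQuot T ℝ).eval 1 ≠ 0 := by
    rw [Polynomial.eval_eq_sum_range]
    refine (Finset.sum_pos' (fun k _ => by simpa using hnonneg k) ⟨0, by simp, ?_⟩).ne'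
    rw [h0]
    norm_num
  have hpos : PositiveNearZero (cyclotomicLcmQuot T ℝ).stepFunction := by
    refine ⟨1, one_pos, ?_⟩
    filter_upwards [ae_restrict_mem measurableSet_Ioo] with t ht
    rw [Polynomial.stepFunction_of_mem_Ioo _ (j := 0) (by simpa using ht), h0]
    exact one_pos
  have horth := isOrthogonalFunction_stepFunction (by norm_num) hT h1
  have hcrit := isCriticalLength_natDegree (by norm_num) hT h1
  refine ⟨_, hcrit, ⟨_, horth, hpos⟩, fun h hh hh0 => ?_⟩
  obtain ⟨r, hr, hae⟩ := horth.exists_pos_mul hcrit.1 hpos hh hh0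
  filter_upwards [hae] with t ht
  rw [ht]
  exact mul_nonneg hr.le (hnonneg _)
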